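/- Let $d\in\mathbb N$, let $\mathbb K\in\{\mathbb R,\mathbb C\}$ be the scalar field, let $\mathscr D(\mathbb R^d)$ be the space of $\mathbb K$-valued smooth compactly supported functions with its usual (LF) topology, $\mathscr D'(\mathbb R^d)$ its dual (the space of distributions), and $\mathbb R_*^d=(\mathbb R\setminus\{0\})^d$. For $x,y\in\mathbb R^d$ put $xy=(x_1y_1,\dots,x_dy_d)$. Let $\mathscr D_H(\mathbb R^d)$ be the set of all distributions $T\in\mathscr D'(\mathbb R^d)$ such that for every $\varphi\in\mathscr D(\mathbb R^d)$ the function $y\mapsto T_\xi\,\varphi(\xi y)$, $y\in\mathbb R_*^d$, is the restriction to $\mathbb R_*^d$ of a function in $\mathscr D(\mathbb R^d)$. Lemma. Every $T\in\mathscr D_H(\mathbb R^d)$ is tempered, that is, $\mathscr D_H(\mathbb R^d)\subset\mathscr S'(\mathbb R^d)$: for every $T\in\mathscr D_H(\mathbb R^d)$ there is a continuous linear functional on the Schwartz space $\mathscr S(\mathbb R^d)$ whose restriction to $\mathscr D(\mathbb R^d)$ is $T$. -/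

import Mathlib

open scoped Distributions SchwartzMap ContDiff

noncomputable section

namespace Hadamard

/-- The space `ℝ^d`. (Smoothness, compact supports, test functions and Schwartz functions depend
only on its structure as a finite-dimensional topological vector space; `*` on it is the
coordinatewise product `xy = (x₁y₁, …, x_d y_d)`.) -/
abbrev RSpace (d : ℕ) : Type := Fin d → ℝ

/-- The space `𝓓(ℝ^d)` of `𝕜`-valued smooth compactly supported functions, with its canonical
LF topology. -/
abbrev TestFun (𝕜 : Type*) [RCLike 𝕜] (d : ℕ) : Type _ :=
  𝓓((⊤ : TopologicalSpace.Opens (RSpace d)), 𝕜)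

/-- The space `𝓓'(ℝ^d)` of distributions: continuous `𝕜`-linear functionals on `𝓓(ℝ^d)`. -/
abbrev Distr (𝕜 : Type*) [RCLike 𝕜] (d : ℕ) : Type _ :=
  TestFun 𝕜 d →L[𝕜] 𝕜

/-- The set `ℝ_*^d = (ℝ ∖ {0})^d`. -/
def offHyperplanes (d : ℕ) : Set (RSpace d) := {y | ∀ j, y j ≠ 0}

/-- For `y ∈ ℝ_*^d` and `φ ∈ 𝓓(ℝ^d)`, the test function `ξ ↦ φ(ξy)`. -/
def dilate {𝕜 : Type*} [RCLike 𝕜] {d : ℕ} (y : offHyperplanes d) (φ : TestFun 𝕜 d) :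
    TestFun 𝕜 d where
  toFun ξ := φ (ξ * y)
  contDiff' := φ.contDiff.comp (contDiff_id.mul contDiff_const)
  hasCompactSupport' := by
    let e : RSpace d ≃ₜ RSpace d := Homeomorph.piCongrRight
      (fun j => Homeomorph.mulRight₀ ((y : RSpace d) j) (y.2 j))
    exact φ.hasCompactSupport.comp_homeomorph e
  tsupport_subset' := fun _ _ => trivial

@[simp]
theorem dilate_apply {𝕜 : Type*} [RCLike 𝕜] {d : ℕ} (y : offHyperplanes d) (φ : TestFun 𝕜 d)
    (ξ : RSpace d) : dilate y φ ξ = φ (ξ * y) := rfl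

/-- The class `𝓓_H(ℝ^d)`: all distributions `T` such that for every test function `φ` the function
`y ↦ T_ξ φ(ξy)`, `y ∈ ℝ_*^d`, is the restriction to `ℝ_*^d` of a test function. -/
def DH (𝕜 : Type*) [RCLike 𝕜] (d : ℕ) : Set (Distr 𝕜 d) :=
  {T | ∀ φ : TestFun 𝕜 d, ∃ ψ : TestFun 𝕜 d, ∀ y : offHyperplanes d, T (dilate y φ) = ψ y}

/-- A test function, regarded as an element of the Schwartz space `𝓢(ℝ^d)`. -/
def toSchwartz {𝕜 : Type*} [RCLike 𝕜] {d : ℕ} (φ : TestFun 𝕜 d) : 𝓢(RSpace d, 𝕜) :=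
  φ.hasCompactSupport.toSchwartzMap φ.contDiff

@[simp]
theorem toSchwartz_apply {𝕜 : Type*} [RCLike 𝕜] {d : ℕ} (φ : TestFun 𝕜 d) (x : RSpace d) :
    toSchwartz φ x = φ x := rfl

/-- The space `𝓢'(ℝ^d)` of tempered distributions, as a subset of `𝓓'(ℝ^d)`: the distributions that
are restrictions to `𝓓(ℝ^d)` of continuous `𝕜`-linear functionals on `𝓢(ℝ^d)`. -/
def tempered (𝕜 : Type*) [RCLike 𝕜] (d : ℕ) : Set (Distr 𝕜 d) :=
  {T | ∃ S : 𝓢(RSpace d, 𝕜) →L[𝕜] 𝕜, ∀ φ : TestFun 𝕜 d, T φ = S (toSchwartz φ)}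

end Hadamard

end

open TopologicalSpace Filter

noncomputable section

namespace Hadamard

/-! ### Uniform boundedness on `𝓓_K`, by way of `ℓ¹`. -/

section UniformBoundedness

variable {𝕜 : Type*} [RCLike 𝕜] {E F : Type*} [NormedAddCommGroup E] [NormedSpace ℝ E]
  [NormedAddCommGroup F] [NormedSpace ℝ F] [NormedSpace 𝕜 F] [SMulCommClass ℝ 𝕜 F]
  {K : Compacts E}

/-! Let `K` be the ball of radius 2. For fixed `g` in `𝓓_K`, membership in `DH` makes the numbers
`T_ξ g(2⁻ᵏξ)` values of a single test function, hence bounded in `k`. Banach–Steinhaus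
(`exists_bound_of_pointwise_bounded`) then bounds all these functionals by one seminorm of some
order `N`. Cut a Schwartz function `f` into dyadic shells, `f(x) = ∑ gₖ(2⁻ᵏx)` with `gₖ(x) = ηₖ(x)
f(2ᵏx)`. Rapid decay makes the order-`N` seminorm of `gₖ` at most `2⁻ᵏ` times a fixed Schwartz
seminorm of `f`, up to a constant (`supSeminorm_localize_le`). So `∑ₖ T_ξ gₖ(2⁻ᵏξ)` converges to a
continuous functional of `f`; on test functions the sum telescopes to `T`. -/

theorem summable_norm_lp_one {α : Type*} (a : lp (fun _ : α => 𝕜) 1) :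
    Summable fun i => ‖a i‖ := by
  simpa using (lp.memℓp a).summable (by simp)

theorem norm_lp_one {α : Type*} (a : lp (fun _ : α => 𝕜) 1) : ‖a‖ = ∑' i, ‖a i‖ := by
  simpa using lp.norm_eq_tsum_rpow (by simp) a

theorem norm_iteratedFDeriv_const_smul_le {φ : 𝓓_{K}(E, F)} {i : ℕ} {M : ℝ}
    (hM : N[𝕜]_{K, i} φ ≤ M) (c : 𝕜) (x : E) :
    ‖iteratedFDeriv ℝ i (fun y => c • φ y) x‖ ≤ ‖c‖ * M := by
  have h := ContDiffMapSupportedIn.norm_iteratedFDeriv_apply_le_seminorm (n := ⊤) (i := i) 𝕜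
    le_top (f := c • φ) (x := x)
  rw [map_smul_eq_mul] at h
  exact h.trans (mul_le_mul_of_nonneg_left hM (norm_nonneg c))

variable [CompleteSpace F]

/-- The function `x ↦ ∑ aₙ φₙ(x)` for a summable sequence `a` and a bounded sequence `φ` in
`𝓓_K`. -/
def summableCombination (φ : ℕ → 𝓓_{K}(E, F)) (M : ℕ → ℝ)
    (hM : ∀ i n, N[𝕜]_{K, i} (φ n) ≤ M i) (a : lp (fun _ : ℕ => 𝕜) 1) : 𝓓_{K}(E, F) where
  toFun x := ∑' n, a n • φ n x
  contDiff' := contDiff_tsum (v := fun i n => ‖a n‖ * M i)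
    (fun n => (φ n).contDiff.const_smul (a n))
    (fun _ _ => (summable_norm_lp_one a).mul_right _)
    (fun i n x _ => norm_iteratedFDeriv_const_smul_le (hM i n) _ x)
  zero_on_compl' x hx := by simp [(φ _).zero_on_compl hx]

theorem summable_smul_apply {φ : ℕ → 𝓓_{K}(E, F)} {M : ℕ → ℝ}
    (hM : ∀ i n, N[𝕜]_{K, i} (φ n) ≤ M i) (a : lp (fun _ : ℕ => 𝕜) 1) (x : E) :
    Summable fun n => a n • φ n x := by
  refine Summable.of_norm_bounded ((summable_norm_lp_one a).mul_right (M 0)) fun n => ?_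
  simpa using norm_iteratedFDeriv_const_smul_le (hM 0 n) (a n) x

theorem seminorm_summableCombination_le (φ : ℕ → 𝓓_{K}(E, F)) (M : ℕ → ℝ)
    (hM : ∀ i n, N[𝕜]_{K, i} (φ n) ≤ M i) (a : lp (fun _ : ℕ => 𝕜) 1) (i : ℕ) :
    N[𝕜]_{K, i} (summableCombination φ M hM a) ≤ M i * ‖a‖ := by
  have hM0 : 0 ≤ M i := (apply_nonneg _ _).trans (hM i 0)
  rw [ContDiffMapSupportedIn.seminorm_top_le_iff 𝕜 (by positivity)]
  intro x _
  have hs : Summable fun n => ‖a n‖ * M i := (summable_norm_lp_one a).mul_right _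
  have h := iteratedFDeriv_tsum_apply (𝕜 := ℝ) (N := ⊤) (v := fun i n => ‖a n‖ * M i)
    (fun n => (φ n).contDiff.const_smul (a n))
    (fun _ _ => (summable_norm_lp_one a).mul_right _)
    (fun i n x _ => norm_iteratedFDeriv_const_smul_le (hM i n) _ x) (k := i) le_top x
  change ‖iteratedFDeriv ℝ i (fun y => ∑' n, a n • φ n y) x‖ ≤ _
  refine (congrArg norm h).trans_le ?_
  rw [norm_lp_one, mul_comm, ← tsum_mul_right]
  exact tsum_of_norm_bounded hs.hasSum
    fun n => norm_iteratedFDeriv_const_smul_le (hM i n) _ x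

/-- `summableCombination` as a continuous linear map `ℓ¹ → 𝓓_K`. -/
def summableCombinationCLM (φ : ℕ → 𝓓_{K}(E, F)) (M : ℕ → ℝ)
    (hM : ∀ i n, N[𝕜]_{K, i} (φ n) ≤ M i) : lp (fun _ : ℕ => 𝕜) 1 →L[𝕜] 𝓓_{K}(E, F) :=
  letI Φ : lp (fun _ : ℕ => 𝕜) 1 →ₗ[𝕜] 𝓓_{K}(E, F) :=
    { toFun := summableCombination φ M hM
      map_add' a b := by
        ext x
        change ∑' n, (a n + b n) • φ n x = (∑' n, a n • φ n x) + ∑' n, b n • φ n x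
        simp_rw [add_smul]
        exact (summable_smul_apply hM a x).tsum_add (summable_smul_apply hM b x)
      map_smul' c a := by
        ext x
        change ∑' n, (c * a n) • φ n x = c • ∑' n, a n • φ n x
        simp_rw [mul_smul]
        exact (summable_smul_apply hM a x).tsum_const_smul c }
  { toLinearMap := Φ
    cont := WithSeminorms.continuous_normedSpace_dom _
        (ContDiffMapSupportedIn.withSeminorms 𝕜 E F ⊤ K) Φ fun i =>
          ⟨⟨M i, (apply_nonneg _ _).trans (hM i 0)⟩, fun a =>
            seminorm_summableCombination_le φ M hM a i⟩ }

theorem summableCombinationCLM_single (φ : ℕ → 𝓓_{K}(E, F)) (M : ℕ → ℝ)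
    (hM : ∀ i n, N[𝕜]_{K, i} (φ n) ≤ M i) (n : ℕ) :
    summableCombinationCLM φ M hM (lp.single 1 n 1) = φ n := by
  ext x
  change ∑' m, (lp.single 1 n (1 : 𝕜) : lp (fun _ : ℕ => 𝕜) 1) m • φ m x = φ n x
  rw [tsum_eq_single n fun m hm => by rw [lp.single_apply_ne _ _ _ hm, zero_smul],
    lp.single_apply_self, one_smul]

/-- The Banach–Steinhaus theorem for functionals on `𝓓_K`. -/
theorem exists_bound_of_pointwise_bounded {ι : Type*} (L : ι → 𝓓_{K}(E, F) →L[𝕜] 𝕜)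
    (hL : ∀ f, ∃ C, ∀ i, ‖L i f‖ ≤ C) :
    ∃ (N : ℕ) (C : ℝ), 0 ≤ C ∧
      ∀ i f, ‖L i f‖ ≤ C * ContDiffMapSupportedIn.supSeminorm 𝕜 E F ⊤ K N f := by
  by_contra! H
  choose i f hf using fun n : ℕ => H n n n.cast_nonneg
  have hpos n : 0 < ‖L (i n) (f n)‖ := (mul_nonneg n.cast_nonneg (apply_nonneg _ _)).trans_lt (hf n)
  -- Rescaled so that the functional takes a value of modulus `n` while the order-`n` seminorm stays
  -- at most 1.
  set φ : ℕ → 𝓓_{K}(E, F) := fun n => ((n / ‖L (i n) (f n)‖ : ℝ) : 𝕜) • f n with hφ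
  have hφ1 n : ContDiffMapSupportedIn.supSeminorm 𝕜 E F ⊤ K n (φ n) ≤ 1 := by
    have := hpos n
    rw [hφ, map_smul_eq_mul, RCLike.norm_ofReal, abs_of_nonneg (by positivity),
      div_mul_eq_mul_div, div_le_one this]
    exact (hf n).le
  have hLφ n : ‖L (i n) (φ n)‖ = n := by
    rw [hφ, map_smul, norm_smul, RCLike.norm_ofReal, abs_of_nonneg (by positivity),
      div_mul_cancel₀ _ (hpos n).ne']
  have hM : ∀ k, ∃ M : ℝ, ∀ n, N[𝕜]_{K, k} (φ n) ≤ M := by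
    intro k
    -- The order-`k` seminorm is at most 1 once `n ≥ k`; the sum absorbs the finitely many earlier
    -- terms.
    refine ⟨1 + ∑ n ∈ Finset.range k, N[𝕜]_{K, k} (φ n), fun n => ?_⟩
    have h0 : ∀ n ∈ Finset.range k, 0 ≤ N[𝕜]_{K, k} (φ n) := fun n _ => apply_nonneg _ _
    rcases lt_or_ge n k with h | h
    · have := Finset.single_le_sum h0 (Finset.mem_range.2 h)
      linarith
    · have h1 : N[𝕜]_{K, k} (φ n) ≤ ContDiffMapSupportedIn.supSeminorm 𝕜 E F ⊤ K n (φ n) :=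
        Seminorm.le_finset_sup_apply (Finset.mem_Iic.2 h)
      linarith [hφ1 n, Finset.sum_nonneg h0]
  choose M hM using hM
  -- Pulled back to the Banach space `ℓ¹`, the functionals are pointwise bounded, yet on the unit
  -- vectors they reach every modulus `n`.
  obtain ⟨C, hC⟩ := banach_steinhaus
    (g := fun j => (L j).comp (summableCombinationCLM φ M hM)) fun a => hL _
  obtain ⟨n, hn⟩ := exists_nat_gt C
  refine (hn.trans_le ?_).false
  calc (n : ℝ) = ‖(L (i n)).comp (summableCombinationCLM φ M hM) (lp.single 1 n 1)‖ := by
        rw [ContinuousLinearMap.comp_apply, summableCombinationCLM_single, hLφ]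
    _ ≤ C * ‖(lp.single 1 n 1 : lp (fun _ : ℕ => 𝕜) 1)‖ :=
        ContinuousLinearMap.le_of_opNorm_le _ (hC _) _
    _ = C := by rw [lp.norm_single (by simp), norm_one, mul_one]

end UniformBoundedness

/-! ### Seminorm estimates for rescaled, localized Schwartz functions. -/

section Rescaling

variable {𝕜 : Type*} [RCLike 𝕜] {E F : Type*} [NormedAddCommGroup E] [NormedSpace ℝ E]
  [NormedAddCommGroup F] [NormedSpace ℝ F] [NormedSpace 𝕜 F] [SMulCommClass ℝ 𝕜 F]
  {K : Compacts E}

/-- The function `x ↦ η(x) f(Rx)`. -/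
def localize (η : 𝓓_{K}(E, ℝ)) (R : ℝ) (f : 𝓢(E, F)) : 𝓓_{K}(E, F) where
  toFun x := η x • f (R • x)
  contDiff' := η.contDiff.smul ((f.smooth ⊤).comp (contDiff_const_smul R))
  zero_on_compl' x hx := by simp [η.zero_on_compl hx]

theorem localize_apply (η : 𝓓_{K}(E, ℝ)) (R : ℝ) (f : 𝓢(E, F)) (x : E) :
    localize η R f x = η x • f (R • x) := rfl

theorem localize_add (η : 𝓓_{K}(E, ℝ)) (R : ℝ) (f g : 𝓢(E, F)) :
    localize η R (f + g) = localize η R f + localize η R g := by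
  ext x
  simp [localize_apply]

theorem localize_smul (η : 𝓓_{K}(E, ℝ)) (R : ℝ) (c : 𝕜) (f : 𝓢(E, F)) :
    localize η R (c • f) = c • localize η R f := by
  ext x
  change η x • c • f (R • x) = c • η x • f (R • x)
  exact smul_comm _ _ _

variable (𝕜) in
-- Weight `n + 1` is one more than the `l ≤ n` powers of `R` to be absorbed; the spare power yields
-- `R⁻¹`, the source of the geometric decay.
theorem pow_mul_norm_iteratedFDeriv_le {n l : ℕ} (hl : l ≤ n) (f : 𝓢(E, F)) {R : ℝ} (hR : 1 ≤ R)
    {y : E} (hy : R ≤ 2 * (1 + ‖y‖)) :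
    R ^ l * ‖iteratedFDeriv ℝ l f y‖ ≤
      4 ^ (n + 1) * (R⁻¹ * (Finset.Iic (n + 1, n)).sup (schwartzSeminormFamily 𝕜 E F) f) := by
  have h := SchwartzMap.one_add_le_sup_seminorm_apply (𝕜 := 𝕜) (m := (n + 1, n)) le_rfl hl f y
  change _ ≤ 2 ^ (n + 1) * (Finset.Iic (n + 1, n)).sup (schwartzSeminormFamily 𝕜 E F) f at h
  set p := (Finset.Iic (n + 1, n)).sup (schwartzSeminormFamily 𝕜 E F) f
  have hR0 : 0 < R := by linarith
  calc R ^ l * ‖iteratedFDeriv ℝ l f y‖ ≤ R ^ n * ‖iteratedFDeriv ℝ l f y‖ := by gcongr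
    _ = R⁻¹ * (R ^ (n + 1) * ‖iteratedFDeriv ℝ l f y‖) := by
      rw [pow_succ]; field_simp
    _ ≤ R⁻¹ * ((2 * (1 + ‖y‖)) ^ (n + 1) * ‖iteratedFDeriv ℝ l f y‖) := by gcongr
    _ = R⁻¹ * (2 ^ (n + 1) * ((1 + ‖y‖) ^ (n + 1) * ‖iteratedFDeriv ℝ l f y‖)) := by
      rw [mul_pow, mul_assoc]
    _ ≤ R⁻¹ * (2 ^ (n + 1) * (2 ^ (n + 1) * p)) := by gcongr
    _ = 4 ^ (n + 1) * (R⁻¹ * p) := by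
      rw [show (4 : ℝ) = 2 * 2 by norm_num, mul_pow]; ring

variable (𝕜) in
theorem supSeminorm_localize_le (η : 𝓓_{K}(E, ℝ)) (n : ℕ) {R : ℝ} (hR : 1 ≤ R)
    (hη : ∀ x ∈ tsupport η, R ≤ 2 * (1 + ‖R • x‖)) (f : 𝓢(E, F)) :
    ContDiffMapSupportedIn.supSeminorm 𝕜 E F ⊤ K n (localize η R f) ≤
      2 ^ n * ContDiffMapSupportedIn.supSeminorm ℝ E ℝ ⊤ K n η * 4 ^ (n + 1) * R⁻¹ *
        (Finset.Iic (n + 1, n)).sup (schwartzSeminormFamily 𝕜 E F) f := by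
  set p := (Finset.Iic (n + 1, n)).sup (schwartzSeminormFamily 𝕜 E F) f
  set M := ContDiffMapSupportedIn.supSeminorm ℝ E ℝ ⊤ K n η
  have hM0 : 0 ≤ M := apply_nonneg _ _
  have hp0 : 0 ≤ p := apply_nonneg _ _
  have hR0 : 0 < R := by linarith
  have hC : 0 ≤ 2 ^ n * M * 4 ^ (n + 1) * R⁻¹ * p := by positivity
  refine Seminorm.finset_sup_apply_le hC fun i hi => ?_
  rw [Finset.mem_Iic] at hi
  rw [ContDiffMapSupportedIn.seminorm_top_le_iff 𝕜 hC]
  intro x _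
  have hfR : ContDiff ℝ (⊤ : ℕ∞) fun x => f (R • x) :=
    (f.smooth ⊤).comp (contDiff_const_smul R)
  refine (norm_iteratedFDeriv_smul_le η.contDiff hfR x (n := i) (mod_cast le_top)).trans ?_
  have hterm : ∀ j ∈ Finset.range (i + 1),
      (i.choose j : ℝ) * ‖iteratedFDeriv ℝ j η x‖ *
        ‖iteratedFDeriv ℝ (i - j) (fun x => f (R • x)) x‖ ≤
      (i.choose j : ℝ) * (M * (4 ^ (n + 1) * (R⁻¹ * p))) := by
    intro j hj
    rw [mul_assoc]
    refine mul_le_mul_of_nonneg_left ?_ (Nat.cast_nonneg _)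
    -- The lower bound on `‖R • x‖` is available only on the support of `η`; off it the derivatives
    -- of `η` vanish.
    by_cases hx : x ∈ tsupport η
    · have h1 : ‖iteratedFDeriv ℝ j η x‖ ≤ M :=
        (ContDiffMapSupportedIn.norm_iteratedFDeriv_apply_le_seminorm (n := ⊤) ℝ le_top).trans
          (Seminorm.le_finset_sup_apply (Finset.mem_Iic.2 (by grind)))
      have h2 : ‖iteratedFDeriv ℝ (i - j) (fun x => f (R • x)) x‖ ≤
          4 ^ (n + 1) * (R⁻¹ * p) := by
        rw [iteratedFDeriv_comp_const_smul R (f.smooth _), norm_smul, norm_pow, Real.norm_eq_abs,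
          abs_of_pos hR0]
        exact pow_mul_norm_iteratedFDeriv_le 𝕜 (by omega) f hR (hη x hx)
      gcongr
    · have h0 : iteratedFDeriv ℝ j η x = 0 := by
        by_contra h
        exact hx (support_iteratedFDeriv_subset j h)
      rw [h0, norm_zero, zero_mul]
      positivity
  refine (Finset.sum_le_sum hterm).trans ?_
  rw [← Finset.sum_mul]
  have h2 : ∑ j ∈ Finset.range (i + 1), (i.choose j : ℝ) ≤ 2 ^ n := by
    rw [← Nat.cast_sum, Nat.sum_range_choose]
    push_cast
    exact pow_le_pow_right₀ one_le_two hi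
  calc _ ≤ 2 ^ n * (M * (4 ^ (n + 1) * (R⁻¹ * p))) := by gcongr
    _ = _ := by ring

variable (𝕜 F) in
/-- The dilation `f ↦ f(c ·)` as a continuous linear map `𝓓_K → 𝓓_{K'}`. -/
def dilateCLM {K' : Compacts E} (c : ℝ) (hc : ∀ x, c • x ∈ K → x ∈ K') :
    𝓓_{K}(E, F) →L[𝕜] 𝓓_{K'}(E, F) :=
  ContDiffMapSupportedIn.mkCLM 𝕜 (fun f x => f (c • x)) (fun _ _ _ => rfl) (fun _ _ _ => rfl)
    (fun f => f.contDiff.comp (contDiff_const_smul c))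
    (fun f x hx => f.zero_on_compl fun h => hx (hc x h))
    fun i _ => ⟨{i}, |c| ^ i, by positivity, fun f x _ => by
      rw [iteratedFDeriv_comp_const_smul c (f.contDiff.of_le (mod_cast le_top)), norm_smul,
        norm_pow, Real.norm_eq_abs, Finset.sup_singleton]
      gcongr
      exact ContDiffMapSupportedIn.norm_iteratedFDeriv_apply_le_seminorm 𝕜 le_top⟩

end Rescaling

/-! ### Dyadic decomposition and the tempered extension. -/

section Tempered

variable {𝕜 : Type*} [RCLike 𝕜] {d : ℕ}

/-- The closed ball of radius `2` about the origin. -/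
def doubleBall (d : ℕ) : Compacts (RSpace d) :=
  ⟨Metric.closedBall 0 2, isCompact_closedBall 0 2⟩

theorem mem_doubleBall {x : RSpace d} : x ∈ doubleBall d ↔ ‖x‖ ≤ 2 :=
  mem_closedBall_zero_iff

/-- A smooth function which is `1` on the unit ball and supported in the ball of radius `2`. -/
def unitCutoff (d : ℕ) : 𝓓_{doubleBall d}(RSpace d, ℝ) :=
  letI b : ContDiffBump (0 : RSpace d) := ⟨1, 2, one_pos, one_lt_two⟩
  ContDiffMapSupportedIn.of_support_subset (f := b) b.contDiff
    (b.support_eq.trans_subset Metric.ball_subset_closedBall)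

theorem unitCutoff_eq_one {x : RSpace d} (hx : ‖x‖ ≤ 1) : unitCutoff d x = 1 :=
  ContDiffBump.one_of_mem_closedBall _ (mem_closedBall_zero_iff.2 hx)

/-- The dyadic decomposition of unity `1 = ∑ ηₖ(2⁻ᵏ x)`, before rescaling. -/
def dyadicCutoff (d : ℕ) : ℕ → 𝓓_{doubleBall d}(RSpace d, ℝ)
  | 0 => unitCutoff d
  | _ + 1 => unitCutoff d - dilateCLM ℝ ℝ 2 (fun x hx => by
      rw [mem_doubleBall, norm_smul, Real.norm_two] at hx
      rw [mem_doubleBall]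
      linarith [norm_nonneg x]) (unitCutoff d)

theorem dyadicCutoff_succ_apply (k : ℕ) (x : RSpace d) :
    dyadicCutoff d (k + 1) x = unitCutoff d x - unitCutoff d ((2 : ℝ) • x) := rfl

/-- For positive index both cutoffs equal 1 where `‖x‖ < 1/2`, so their difference vanishes there;
index 0 is trivial. -/
theorem two_pow_le_of_mem_tsupport (k : ℕ) {x : RSpace d} (hx : x ∈ tsupport (dyadicCutoff d k)) :
    (2 : ℝ) ^ k ≤ 2 * (1 + ‖(2 : ℝ) ^ k • x‖) := by
  cases k with
  | zero => linarith [norm_nonneg ((2 : ℝ) ^ 0 • x), pow_zero (2 : ℝ)]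
  | succ k =>
    have hsub : tsupport (dyadicCutoff d (k + 1)) ⊆ {x | 1 ≤ 2 * ‖x‖} := by
      refine closure_minimal (fun y hy => ?_) (isClosed_le (by fun_prop) (by fun_prop))
      by_contra h
      rw [Set.mem_ofPred_eq, not_le] at h
      refine hy ?_
      rw [dyadicCutoff_succ_apply, unitCutoff_eq_one (by linarith [norm_nonneg y]),
        unitCutoff_eq_one (by rw [norm_smul, Real.norm_two]; exact h.le), sub_self]
    have h1 : 1 ≤ 2 * ‖x‖ := hsub hx
    rw [norm_smul, norm_pow, Real.norm_two]
    nlinarith [pow_pos (two_pos (α := ℝ)) (k + 1)]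

theorem exists_supSeminorm_dyadicCutoff_le (d n : ℕ) :
    ∃ M, ∀ k, ContDiffMapSupportedIn.supSeminorm ℝ (RSpace d) ℝ ⊤ (doubleBall d) n
      (dyadicCutoff d k) ≤ M :=
  ⟨max (ContDiffMapSupportedIn.supSeminorm ℝ (RSpace d) ℝ ⊤ (doubleBall d) n (dyadicCutoff d 0))
    (ContDiffMapSupportedIn.supSeminorm ℝ (RSpace d) ℝ ⊤ (doubleBall d) n (dyadicCutoff d 1)),
    fun k => by
      cases k with
      | zero => exact le_max_left _ _
      | succ k => exact le_max_right _ _⟩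

/-- The point `(2⁻ᵏ, …, 2⁻ᵏ)`. -/
def dyadicPoint (d k : ℕ) : offHyperplanes d :=
  ⟨fun _ => ((2 : ℝ) ^ k)⁻¹, fun _ => by positivity⟩

theorem dilate_dyadicPoint_apply (k : ℕ) (φ : TestFun 𝕜 d) (x : RSpace d) :
    dilate (dyadicPoint d k) φ x = φ (((2 : ℝ) ^ k)⁻¹ • x) := by
  rw [dilate_apply]
  congr 1
  ext j
  exact mul_comm _ _

/-- The inclusion of `𝓓_K` into the space of test functions, for `K` the ball of radius `2`. -/
def ofDoubleBall (g : 𝓓_{doubleBall d}(RSpace d, 𝕜)) : TestFun 𝕜 d :=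
  TestFunction.ofSupportedIn (Set.subset_univ _) g

theorem ofDoubleBall_apply (g : 𝓓_{doubleBall d}(RSpace d, 𝕜)) (x : RSpace d) :
    ofDoubleBall g x = g x := rfl

/-- The functional `g ↦ T_ξ g(2⁻ᵏ ξ)` on the test functions supported in the ball of radius `2`. -/
def dyadicFunctional (T : Distr 𝕜 d) (k : ℕ) : 𝓓_{doubleBall d}(RSpace d, 𝕜) →L[𝕜] 𝕜 :=
  letI K' : Compacts (RSpace d) :=
    ⟨Metric.closedBall 0 (2 ^ k * 2), isCompact_closedBall _ _⟩
  T.comp ((TestFunction.ofSupportedInCLM 𝕜 (Set.subset_univ (K' : Set (RSpace d)))).comp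
    (dilateCLM 𝕜 𝕜 ((2 : ℝ) ^ k)⁻¹ fun x hx => by
      rw [mem_doubleBall, norm_smul, norm_inv, norm_pow, Real.norm_two,
        inv_mul_le_iff₀ (by positivity)] at hx
      exact mem_closedBall_zero_iff.2 hx))

theorem dyadicFunctional_apply (T : Distr 𝕜 d) (k : ℕ) (g : 𝓓_{doubleBall d}(RSpace d, 𝕜)) :
    dyadicFunctional T k g = T (dilate (dyadicPoint d k) (ofDoubleBall g)) := by
  refine congrArg T ?_
  ext x
  rw [dilate_dyadicPoint_apply]
  rfl

/-- The only use of `DH`: a test function `ψ` is bounded, in particular along the dyadic points. -/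
theorem exists_norm_dyadicFunctional_le {T : Distr 𝕜 d} (hT : T ∈ DH 𝕜 d) :
    ∃ (N : ℕ) (C : ℝ), 0 ≤ C ∧ ∀ k g, ‖dyadicFunctional T k g‖ ≤
      C * ContDiffMapSupportedIn.supSeminorm 𝕜 (RSpace d) 𝕜 ⊤ (doubleBall d) N g := by
  refine exists_bound_of_pointwise_bounded _ fun g => ?_
  obtain ⟨ψ, hψ⟩ := hT (ofDoubleBall g)
  obtain ⟨C, hC⟩ := ψ.continuous.bounded_above_of_compact_support ψ.hasCompactSupport
  exact ⟨C, fun k => by rw [dyadicFunctional_apply, hψ]; exact hC _⟩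

theorem exists_norm_dyadicFunctional_localize_le {T : Distr 𝕜 d} (hT : T ∈ DH 𝕜 d) :
    ∃ (s : Finset (ℕ × ℕ)) (C : ℝ), 0 ≤ C ∧ ∀ k (f : 𝓢(RSpace d, 𝕜)),
      ‖dyadicFunctional T k (localize (dyadicCutoff d k) (2 ^ k) f)‖ ≤
        C * s.sup (schwartzSeminormFamily 𝕜 (RSpace d) 𝕜) f * (1 / 2) ^ k := by
  obtain ⟨N, C, hC, hT⟩ := exists_norm_dyadicFunctional_le hT
  obtain ⟨M, hM⟩ := exists_supSeminorm_dyadicCutoff_le d N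
  have hM0 : 0 ≤ M := (apply_nonneg _ _).trans (hM 0)
  refine ⟨Finset.Iic (N + 1, N), C * (2 ^ N * M * 4 ^ (N + 1)), by positivity, fun k f => ?_⟩
  set p := (Finset.Iic (N + 1, N)).sup (schwartzSeminormFamily 𝕜 (RSpace d) 𝕜) f
  have hp : 0 ≤ p := apply_nonneg _ _
  have h := supSeminorm_localize_le 𝕜 (dyadicCutoff d k) N
    (one_le_pow₀ one_le_two : (1 : ℝ) ≤ 2 ^ k) (fun x hx => two_pow_le_of_mem_tsupport k hx) f
  calc _ ≤ C * _ := hT k _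
    _ ≤ C * (2 ^ N * M * 4 ^ (N + 1) * (2 ^ k)⁻¹ * p) := by
      refine mul_le_mul_of_nonneg_left (h.trans ?_) hC
      gcongr
      exact hM k
    _ = _ := by rw [one_div, inv_pow]; ring

/-- With `χ` the unit cutoff, the shell of index `k + 1` is `χ(2⁻ᵏ⁻¹x) - χ(2⁻ᵏx)`, so the sum
telescopes. -/
theorem sum_dyadicFunctional_localize (T : Distr 𝕜 d) (f : 𝓢(RSpace d, 𝕜)) (m : ℕ) :
    ∑ k ∈ Finset.range (m + 1), dyadicFunctional T k (localize (dyadicCutoff d k) (2 ^ k) f) =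
      dyadicFunctional T m (localize (unitCutoff d) (2 ^ m) f) := by
  induction m with
  | zero => simp [dyadicCutoff]
  | succ m ih =>
    rw [Finset.sum_range_succ, ih]
    simp_rw [dyadicFunctional_apply]
    rw [← map_add]
    congr 1
    ext x
    have h2 : ((2 : ℝ) ^ m)⁻¹ • x = (2 : ℝ) • ((2 : ℝ) ^ (m + 1))⁻¹ • x := by
      rw [smul_smul, pow_succ, mul_inv_rev, mul_inv_cancel_left₀ two_ne_zero]
    have h3 (j : ℕ) : (2 : ℝ) ^ j • ((2 : ℝ) ^ j)⁻¹ • x = x :=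
      smul_inv_smul₀ (by positivity) x
    change dilate (𝕜 := 𝕜) (dyadicPoint d m) _ x + dilate (𝕜 := 𝕜) (dyadicPoint d (m + 1)) _ x = _
    simp only [dilate_dyadicPoint_apply, ofDoubleBall_apply, localize_apply, h3,
      dyadicCutoff_succ_apply, ← h2]
    rw [← add_smul, add_sub_cancel]

theorem eventually_dyadicFunctional_localize_eq (T : Distr 𝕜 d) (φ : TestFun 𝕜 d) :
    ∀ᶠ m in atTop,
      dyadicFunctional T m (localize (unitCutoff d) (2 ^ m) (toSchwartz φ)) = T φ := by
  obtain ⟨r, hr⟩ := φ.hasCompactSupport.isCompact.isBounded.subset_closedBall 0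
  filter_upwards [(tendsto_pow_atTop_atTop_of_one_lt (one_lt_two (α := ℝ))).eventually_ge_atTop r]
    with m hm
  rw [dyadicFunctional_apply]
  congr 1
  ext x
  rw [dilate_dyadicPoint_apply, ofDoubleBall_apply, localize_apply,
    smul_inv_smul₀ (by positivity), toSchwartz_apply]
  by_cases hx : x ∈ tsupport φ
  · rw [unitCutoff_eq_one, one_smul]
    rw [norm_smul, norm_inv, norm_pow, Real.norm_two, inv_mul_le_iff₀ (by positivity), mul_one]
    exact (mem_closedBall_zero_iff.1 (hr hx)).trans hm
  · rw [image_eq_zero_of_notMem_tsupport hx, smul_zero]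

theorem mem_tempered_of_mem_DH {T : Distr 𝕜 d} (hT : T ∈ DH 𝕜 d) : T ∈ tempered 𝕜 d := by
  obtain ⟨s, C, hC, hbound⟩ := exists_norm_dyadicFunctional_localize_le hT
  have hgeom (f : 𝓢(RSpace d, 𝕜)) := hasSum_geometric_two.mul_left
    (C * s.sup (schwartzSeminormFamily 𝕜 (RSpace d) 𝕜) f)
  have hsum (f : 𝓢(RSpace d, 𝕜)) : Summable fun k =>
      dyadicFunctional T k (localize (dyadicCutoff d k) (2 ^ k) f) :=
    Summable.of_norm_bounded (hgeom f).summable fun k => hbound k f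
  refine ⟨SchwartzMap.mkCLMtoNormedSpace (σ := RingHom.id 𝕜)
    (fun f => ∑' k, dyadicFunctional T k (localize (dyadicCutoff d k) (2 ^ k) f))
    (fun f g => ?_) (fun c f => ?_) ⟨s, C * 2, by positivity, fun f => ?_⟩, fun φ => ?_⟩
  · simp_rw [localize_add, map_add]
    exact (hsum f).tsum_add (hsum g)
  · simp_rw [localize_smul, map_smul]
    exact (hsum f).tsum_const_smul c
  · refine (tsum_of_norm_bounded (hgeom f) fun k => hbound k f).trans_eq ?_
    ring
  -- The shift by one matches the telescoped sums over `range (m + 1)`, which are eventually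
  -- constant.
  · have h1 := (hsum (toSchwartz φ)).hasSum.tendsto_sum_nat.comp (tendsto_add_atTop_nat 1)
    refine tendsto_nhds_unique (tendsto_const_nhds.congr' ?_) h1
    filter_upwards [eventually_dyadicFunctional_localize_eq T φ] with m hm
    rw [← hm, Function.comp_apply, sum_dyadicFunctional_localize]

end Tempered

end Hadamard

end

theorem lemma2p3 (𝕜 : Type*) [RCLike 𝕜] (d : ℕ) :
    Hadamard.DH 𝕜 d ⊆ Hadamard.tempered 𝕜 d :=
  fun _ hT => Hadamard.mem_tempered_of_mem_DH hT
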